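/- Let $\mathcal M$ be a von Neumann algebra acting on a complex Hilbert space, with unit $I$, and let $A\in\mathcal M$ be positive and well-supported, i.e. $\sigma(A)\setminus\{0\}$ is closed, where $\sigma(\cdot)$ denotes the spectrum in $\mathcal M$. Let $\mathcal S_A(\mathcal M)$ be the set of bounded positive linear functionals $f$ on $\mathcal M$ with $f(A)=1$. For $T\in\mathcal M$ put $\|T\|_A=\sup_{f\in\mathcal S_A(\mathcal M)}\sqrt{f(T^*AT)}\in[0,\infty]$ (with $\sup\emptyset=0$), and let $\mathcal M^A=\{T\in\mathcal M:\|T\|_A<\infty\}$. An element $T\in\mathcal M^A$ is called $A$-invertible if there is $S\in\mathcal M^A$ with $ATS=AST=A$, and for $T\in\mathcal M^A$ one puts $\sigma_A(T)=\{\lambda\in\mathbb C:\lambda I-T\text{ is not }A\text{-invertible}\}$. A character of $\mathcal M$ is a nonzero continuous multiplicative linear functional $\mathcal M\to\mathbb C$. Then: 1. If $\mathcal M$ is commutative, then $\mathcal M^A=\mathcal M$, and for every $T\in\mathcal M$ $$\sigma_A(T)=\{\varphi(T):\varphi\text{ is a character of }\mathcal M\text{ with }\varphi(A)\neq0\}\subseteq\sigma(T).$$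 2. (Without assuming $\mathcal M$ commutative.) $A$ is $A$-invertible, and $\sigma_A(A)=\sigma(A)\setminus\{0\}$. -/

import Mathlib

open scoped ComplexOrder ENNReal

noncomputable section

namespace ASpectrum

variable {H : Type*} [NormedAddCommGroup H] [InnerProductSpace ℂ H] [CompleteSpace H]

/-- The underlying C*-algebra (a type) of a von Neumann algebra `M` acting on `H`; it carries the
operator norm and its topology. -/
abbrev Elem (M : VonNeumannAlgebra H) : Type _ := M.toStarSubalgebra

/-- An element of `M` is positive if it is a positive operator on `H`. -/
def IsPos {M : VonNeumannAlgebra H} (T : Elem M) : Prop :=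
  (T : H →L[ℂ] H).IsPositive

/-- The set `S_A(M)` of the positive (continuous) linear functionals `f` on `M` such that
`f(A) = 1`. -/
def states {M : VonNeumannAlgebra H} (A : Elem M) : Set (Elem M →L[ℂ] ℂ) :=
  {f | (∀ T : Elem M, IsPos T → 0 ≤ f T) ∧ f A = 1}

/-- The extended seminorm `‖T‖_A = sup {√ f(T* A T) : f ∈ S_A(M)} ∈ [0, ∞]`.
For `f ∈ S_A(M)` and `A` positive the number `f(T* A T)` is real and nonnegative. -/
def aNorm {M : VonNeumannAlgebra H} (A T : Elem M) : ℝ≥0∞ :=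
  ⨆ f ∈ states A, ENNReal.ofReal (Real.sqrt (f (star T * A * T)).re)

/-- `M^A`, the set of the `T ∈ M` with `‖T‖_A < ∞`. -/
def bounded {M : VonNeumannAlgebra H} (A : Elem M) : Set (Elem M) :=
  {T | aNorm A T < ∞}

/-- `T` is `A`-invertible in `M^A`: `T ∈ M^A` and there is `S ∈ M^A` with
`A T S = A S T = A`. -/
def IsAInvertible {M : VonNeumannAlgebra H} (A T : Elem M) : Prop :=
  T ∈ bounded A ∧ ∃ S ∈ bounded A, A * T * S = A ∧ A * S * T = A

/-- The `A`-spectrum `σ_A(T)`, for `T ∈ M^A`. -/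
def aSpectrum {M : VonNeumannAlgebra H} (A T : Elem M) : Set ℂ :=
  {z | ¬ IsAInvertible A (z • (1 : Elem M) - T)}

/-- `A` is well-supported: `σ(A) \ {0}` is closed. -/
def WellSupported {M : VonNeumannAlgebra H} (A : Elem M) : Prop :=
  IsClosed (spectrum ℂ A \ {0})

end ASpectrum

end

/-! Since `A` is well-supported, `0` is at most an isolated point of its spectrum, so inversion with
`0 ↦ 0` is continuous there. Functional calculus then gives `B` in `M` commuting with `A` and
satisfying `A * B * A = A`. The idempotent `P = B * A` cuts out the part of the algebra seen by `A`,
and `A`-invertibility is inversion on that part. In the commutative case `φ P = 1` exactly when `φ A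
≠ 0`, so Gelfand theory applied to `T * P + (1 - P)` gives the spectrum. For `T = A`, the element `z
- A` acts as `z` off `P`, so only `z = 0` needs separate treatment. -/

/-- In a commutative complex Banach algebra every non-unit is annihilated by a character. -/
theorem exists_character_apply_eq_zero_of_not_isUnit {R : Type*} [NormedRing R]
    [NormedAlgebra ℂ R] [CompleteSpace R] (hcomm : ∀ a b : R, a * b = b * a) {a : R}
    (ha : ¬ IsUnit a) : ∃ φ : WeakDual.characterSpace ℂ R, φ a = 0 := by
  let _ : NormedCommRing R := { ‹NormedRing R› with mul_comm := hcomm }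
  exact WeakDual.CharacterSpace.exists_apply_eq_zero ha

/-- A normal element of a C*-algebra whose nonzero spectrum is closed has a commuting generalized
inverse. -/
theorem exists_commute_generalized_inverse {R : Type*} [CStarAlgebra R] (a : R) [IsStarNormal a]
    (ha : IsClosed (spectrum ℂ a \ {0})) : ∃ b : R, Commute b a ∧ a * b * a = a := by
  have hcont : ContinuousOn (fun z : ℂ ↦ z⁻¹) (spectrum ℂ a) := by
    intro z hz
    by_cases hz0 : z = 0
    · subst hz0
      -- Near `0` the spectrum contains at most `0` itself, and there `0⁻¹ = 0`.
      have hev : ∀ᶠ w in nhds (0 : ℂ), w ∉ spectrum ℂ a \ {0} :=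
        ha.isOpen_compl.mem_nhds (by simp)
      refine (continuousWithinAt_const (b := (0 : ℂ))).congr_of_eventuallyEq ?_ inv_zero
      filter_upwards [nhdsWithin_le_nhds hev, self_mem_nhdsWithin] with w hw hws
      have : w = 0 := by
        by_contra h
        exact hw ⟨hws, h⟩
      simp [this]
    · exact (continuousAt_inv₀ hz0).continuousWithinAt
  refine ⟨cfc (fun z : ℂ ↦ z⁻¹) a, ?_, ?_⟩
  · have := cfc_commute_cfc (fun z : ℂ ↦ z⁻¹) id a
    rwa [cfc_id ℂ a] at this
  · calc a * cfc (fun z : ℂ ↦ z⁻¹) a * a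
        = cfc id a * cfc (fun z : ℂ ↦ z⁻¹) a * cfc id a := by rw [cfc_id ℂ a]
      _ = cfc (fun z : ℂ ↦ id z * z⁻¹ * id z) a := by
        rw [← cfc_mul id (fun z : ℂ ↦ z⁻¹) a continuousOn_id hcont,
          ← cfc_mul (fun z : ℂ ↦ id z * z⁻¹) id a (continuousOn_id.mul hcont) continuousOn_id]
      _ = a := by simp only [id, mul_inv_mul_cancel, cfc_id' ℂ a]

/-- If `a` has a commuting generalized inverse, `z ≠ 0`, and `z - a` is invertible relative to `a`,
then `z - a` is invertible. -/
theorem isUnit_of_relative_inverse {R : Type*} [Ring R] [Algebra ℂ R] {a b s : R} {z : ℂ}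
    (hz : z ≠ 0) (hba : Commute b a) (hab : a * b * a = a)
    (hr : a * (z • (1 : R) - a) * s = a) (hl : a * s * (z • (1 : R) - a) = a) :
    IsUnit (z • (1 : R) - a) := by
  set c := z • (1 : R) - a with hc
  have hac : a * c = c * a := by simp [hc, mul_sub, sub_mul]
  have hbc : b * c = c * b := by simp [hc, mul_sub, sub_mul, hba.eq]
  -- As `(1 - b * a) * a = 0`, the factor `c` acts as `z` on the complement of `b * a`.
  have hqc : z⁻¹ • (1 - b * a) * c = 1 - b * a := by
    have : b * a * a = a := by rw [hba.eq, hab]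
    rw [hc, mul_sub, mul_smul_comm, mul_one, smul_smul, mul_inv_cancel₀ hz, one_smul,
      smul_mul_assoc, sub_mul, this, one_mul, sub_self, smul_zero, sub_zero]
  have hcq : c * (z⁻¹ • (1 - b * a)) = 1 - b * a := by
    rw [mul_smul_comm, mul_sub, mul_one, ← mul_assoc, ← hbc, mul_assoc, ← hac, ← mul_assoc]
    rw [smul_mul_assoc, sub_mul, one_mul] at hqc
    exact hqc
  -- The inverse is glued from `s` on the `b * a` part and `z⁻¹` on its complement.
  refine isUnit_iff_exists.2 ⟨b * a * s + z⁻¹ • (1 - b * a), ?_, ?_⟩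
  · have : c * (b * a * s) = b * a := by
      calc c * (b * a * s) = (c * b) * a * s := by simp only [mul_assoc]
        _ = b * (c * a) * s := by rw [← hbc]; simp only [mul_assoc]
        _ = b * (a * c * s) := by rw [← hac]; simp only [mul_assoc]
        _ = b * a := by rw [hr]
    rw [mul_add, hcq, this, add_sub_cancel]
  · rw [add_mul, hqc, mul_assoc b, mul_assoc b, hl, add_sub_cancel]

namespace ASpectrum

variable {H : Type*} [NormedAddCommGroup H] [InnerProductSpace ℂ H] [CompleteSpace H]

/-- By the double commutant property `M` is a centralizer, hence norm closed. -/
theorem isClosed_coe_toStarSubalgebra (M : VonNeumannAlgebra H) :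
    IsClosed (M.toStarSubalgebra : Set (H →L[ℂ] H)) := by
  have h : (M.toStarSubalgebra : Set (H →L[ℂ] H)) =
      Set.centralizer (Set.centralizer (M : Set (H →L[ℂ] H))) :=
    M.centralizer_centralizer.symm
  rw [h]
  exact Set.isClosed_centralizer _

/-- The C*-algebra structure of a von Neumann algebra. -/
noncomputable abbrev cStarAlgebraElem (M : VonNeumannAlgebra H) : CStarAlgebra (Elem M) :=
  StarSubalgebra.cstarAlgebra _ (h_closed := isClosed_coe_toStarSubalgebra M)

instance (M : VonNeumannAlgebra H) : CompleteSpace (Elem M) :=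
  (isClosed_coe_toStarSubalgebra M).completeSpace_coe

variable {M : VonNeumannAlgebra H} {A T : Elem M}

theorem IsPos.isSelfAdjoint (hA : IsPos A) : IsSelfAdjoint A :=
  Subtype.ext (ContinuousLinearMap.IsPositive.isSelfAdjoint hA).star_eq

/-- Elements commuting with `A` belong to `M^A`. -/
theorem mem_bounded_of_commute (hA : IsPos A) (hT : Commute T A) : T ∈ bounded A := by
  have hsT : Commute (star T) A := by
    have := hT.star_star
    rwa [hA.isSelfAdjoint.star_eq] at this
  -- The difference is `(‖T‖ ^ 2 - star T * T) * A`, a product of commuting positive operators.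
  have hpos : IsPos (((‖T‖ ^ 2 : ℝ) : ℂ) • A - star T * A * T) := by
    rw [IsPos, ← ContinuousLinearMap.nonneg_iff_isPositive]
    set a : H →L[ℂ] H := (A : H →L[ℂ] H)
    set t : H →L[ℂ] H := (T : H →L[ℂ] H)
    have ha : 0 ≤ a := (ContinuousLinearMap.nonneg_iff_isPositive _).2 hA
    have hta : Commute t a := congrArg Subtype.val hT
    have hsta : Commute (star t) a := congrArg Subtype.val hsT
    have hb : 0 ≤ algebraMap ℝ (H →L[ℂ] H) (‖t‖ ^ 2) - star t * t :=
      sub_nonneg.2 CStarAlgebra.star_mul_le_algebraMap_norm_sq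
    have hcomm : Commute (algebraMap ℝ (H →L[ℂ] H) (‖t‖ ^ 2) - star t * t) a :=
      (Algebra.commute_algebraMap_left _ a).sub_left (hsta.mul_left hta)
    have h := hcomm.mul_nonneg hb ha
    have e : ((((‖T‖ ^ 2 : ℝ) : ℂ) • A - star T * A * T : Elem M) : H →L[ℂ] H) =
        (algebraMap ℝ (H →L[ℂ] H) (‖t‖ ^ 2) - star t * t) * a := by
      change ((‖t‖ ^ 2 : ℝ) : ℂ) • a - star t * a * t = _
      rw [sub_mul, ← Algebra.smul_def, Complex.coe_smul, mul_assoc, mul_assoc, hta.eq]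
    rwa [e]
  refine lt_of_le_of_lt (iSup₂_le fun f hf ↦ ENNReal.ofReal_le_ofReal (Real.sqrt_le_sqrt ?_))
    (ENNReal.ofReal_lt_top (r := Real.sqrt (‖T‖ ^ 2)))
  have h := (Complex.le_def.1 (hf.1 _ hpos)).1
  rw [map_sub, map_smul, hf.2, smul_eq_mul, mul_one, Complex.sub_re, Complex.ofReal_re,
    Complex.zero_re] at h
  exact sub_nonneg.1 h

theorem WellSupported.exists_generalized_inverse (hA : IsPos A) (hws : WellSupported A) :
    ∃ B : Elem M, Commute B A ∧ A * B * A = A := by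
  have : IsStarNormal A := hA.isSelfAdjoint.isStarNormal
  let _ := cStarAlgebraElem M
  exact exists_commute_generalized_inverse A hws

theorem bounded_eq_univ_of_commutative (hcomm : ∀ S T : Elem M, S * T = T * S) (hA : IsPos A) :
    bounded A = Set.univ :=
  Set.eq_univ_of_forall fun T ↦ mem_bounded_of_commute hA (hcomm T A)

theorem isAInvertible_iff_of_commutative (hcomm : ∀ S T : Elem M, S * T = T * S) (hA : IsPos A)
    (hws : WellSupported A) :
    IsAInvertible A T ↔ ∀ φ : WeakDual.characterSpace ℂ (Elem M), φ A ≠ 0 → φ T ≠ 0 := by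
  constructor
  · rintro ⟨-, S, -, h, -⟩ φ hφA hφT
    apply hφA
    rw [← h, map_mul, map_mul, hφT, mul_zero, zero_mul]
  · intro h
    obtain ⟨B, hBA, hB⟩ := hws.exists_generalized_inverse hA
    -- This element is `T` on the support of `A` and `1` off it, so a character killing it would
    -- have `φ A ≠ 0` and `φ T = 0`.
    have hunit : IsUnit (T * (B * A) + (1 - B * A)) := by
      by_contra hn
      obtain ⟨φ, hφ⟩ := exists_character_apply_eq_zero_of_not_isUnit hcomm hn
      rw [map_add, map_sub, map_one, map_mul, map_mul] at hφ
      by_cases hφA : φ A = 0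
      · simp [hφA] at hφ
      · have hBA1 : φ B * φ A = 1 := by
          have := congrArg φ hB
          rw [map_mul, map_mul, mul_assoc] at this
          exact mul_left_cancel₀ hφA (this.trans (mul_one _).symm)
        rw [hBA1, mul_one, sub_self, add_zero] at hφ
        exact h φ hφA hφ
    obtain ⟨S, hS, -⟩ := isUnit_iff_exists.1 hunit
    have key : A * T * S = A := by
      have h1 : A * (T * (B * A) + (1 - B * A)) = A * T := by
        rw [mul_add, mul_sub, mul_one, ← mul_assoc A B A, hB, sub_self, add_zero, hcomm T,
          ← mul_assoc, ← mul_assoc, hB]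
      rw [← h1, mul_assoc, hS, mul_one]
    have hb := bounded_eq_univ_of_commutative hcomm hA
    exact ⟨hb ▸ Set.mem_univ T, S, hb ▸ Set.mem_univ S, key,
      by rw [mul_assoc, hcomm S, ← mul_assoc, key]⟩

theorem aSpectrum_eq_of_commutative (hcomm : ∀ S T : Elem M, S * T = T * S) (hA : IsPos A)
    (hws : WellSupported A) (T : Elem M) :
    aSpectrum A T =
      {z : ℂ | ∃ φ : WeakDual.characterSpace ℂ (Elem M), φ A ≠ 0 ∧ φ T = z} := by
  ext z
  simp only [aSpectrum, Set.mem_ofPred_eq, isAInvertible_iff_of_commutative hcomm hA hws, map_sub,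
    map_smul, map_one, smul_eq_mul, mul_one, sub_ne_zero, not_forall, exists_prop, not_not,
    ne_eq, eq_comm (a := z)]

theorem isAInvertible_self (hA : IsPos A) (hws : WellSupported A) : IsAInvertible A A := by
  obtain ⟨B, hBA, hB⟩ := hws.exists_generalized_inverse hA
  refine ⟨mem_bounded_of_commute hA (Commute.refl A), B, mem_bounded_of_commute hA hBA, ?_, hB⟩
  rw [mul_assoc, ← hBA.eq, ← mul_assoc, hB]

theorem aSpectrum_self (hA : IsPos A) (hws : WellSupported A) :
    aSpectrum A A = spectrum ℂ A \ {0} := by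
  ext z
  have hcomm : Commute (z • (1 : Elem M) - A) A :=
    ((Commute.one_left A).smul_left z).sub_left (Commute.refl A)
  simp only [aSpectrum, Set.mem_ofPred_eq, Set.mem_sdiff, Set.mem_singleton_iff, spectrum.mem_iff,
    Algebra.algebraMap_eq_smul_one]
  rw [← not_iff_not, not_not, not_and_not_right]
  constructor
  · rintro ⟨-, S, -, hr, hl⟩ hu
    by_contra hz
    obtain ⟨B, hBA, hB⟩ := hws.exists_generalized_inverse hA
    exact hu (isUnit_of_relative_inverse hz hBA hB hr hl)
  · intro h
    by_cases hz : z = 0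
    · obtain ⟨B, hBA, hB⟩ := hws.exists_generalized_inverse hA
      refine ⟨mem_bounded_of_commute hA hcomm, -B, mem_bounded_of_commute hA hBA.neg_left, ?_, ?_⟩
      · rw [hz, zero_smul, zero_sub, mul_neg, mul_neg, neg_mul, neg_neg, mul_assoc, ← hBA.eq, ← mul_assoc, hB]
      · rw [hz, zero_smul, zero_sub, mul_neg, mul_neg, neg_mul, neg_neg, hB]
    · have hu : IsUnit (z • (1 : Elem M) - A) := by
        by_contra hn
        exact hz (h hn)
      obtain ⟨u, hu⟩ := hu
      rw [← hu] at hcomm ⊢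
      refine ⟨mem_bounded_of_commute hA hcomm, ↑u⁻¹,
        mem_bounded_of_commute hA hcomm.units_inv_left, ?_, ?_⟩
      · rw [mul_assoc, Units.mul_inv, mul_one]
      · rw [mul_assoc, Units.inv_mul, mul_one]

end ASpectrum

theorem corollary2p6 {H : Type*} [NormedAddCommGroup H] [InnerProductSpace ℂ H]
    [CompleteSpace H] (M : VonNeumannAlgebra H) (A : ASpectrum.Elem M)
    (hpos : ASpectrum.IsPos A) (hws : ASpectrum.WellSupported A) :
    ((∀ S T : ASpectrum.Elem M, S * T = T * S) →
      ASpectrum.bounded A = Set.univ ∧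
      ∀ T : ASpectrum.Elem M,
        ASpectrum.aSpectrum A T =
          {z : ℂ | ∃ φ : WeakDual.characterSpace ℂ (ASpectrum.Elem M), φ A ≠ 0 ∧ φ T = z} ∧
        ASpectrum.aSpectrum A T ⊆ spectrum ℂ T) ∧
    (ASpectrum.IsAInvertible A A ∧
      ASpectrum.aSpectrum A A = spectrum ℂ A \ {0}) := by
  refine ⟨fun hcomm ↦ ⟨ASpectrum.bounded_eq_univ_of_commutative hcomm hpos, fun T ↦ ?_⟩,
    ASpectrum.isAInvertible_self hpos hws, ASpectrum.aSpectrum_self hpos hws⟩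
  have h := ASpectrum.aSpectrum_eq_of_commutative hcomm hpos hws T
  refine ⟨h, ?_⟩
  rw [h]
  rintro _ ⟨φ, -, rfl⟩
  exact AlgHom.apply_mem_spectrum φ T
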